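/- Let $f:\mathbb{R}^d\to\mathbb{R}$ be differentiable and $L$-smooth with $L>0$, i.e. $f(x)\le f(y)+\langle\nabla f(y),x-y\rangle+\frac L2\|x-y\|^2$ for all $x,y$, and $\rho$-quasar convex with $\rho>0$ with respect to a global minimizer $w_*$ of $f$, i.e. $f(w_*)\ge f(w)+\frac1\rho\langle\nabla f(w),w_*-w\rangle$ for all $w$. Let $T_0=0$ and let the increments $T_1-T_0,\,T_2-T_1,\dots$ be i.i.d. exponential random variables with mean $1$. Given initial points $\tilde w_0,\tilde z_0\in\mathbb{R}^d$, define for $k\ge 0$ $$\tilde v_k=\tilde w_k+\tau_k(\tilde z_k-\tilde w_k),\qquad \tilde w_{k+1}=\tilde v_k-\tilde\gamma_{k+1}\nabla f(\tilde v_k),\qquad \tilde z_{k+1}=\tilde z_k+\tau'_k(\tilde v_k-\tilde z_k)-\tilde\gamma'_{k+1}\nabla f(\tilde v_k),$$ with $\tau_k=1-\left(\frac{T_k}{T_{k+1}}\right)^{2/\rho}$, $\tau'_k=0$, $\tilde\gamma_k=\frac1L$, $\tilde\gamma'_k=\frac{\rho T_k}{2L}$. Then for every $c\in(0,1)$, every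 $c_0>1$ and every integer $k\ge1$, with probability at least $1-\frac1{c^2k}-\frac1{c_0}$, $$f(\tilde w_k)-f(w_*)\le\frac{2c_0L\|\tilde z_0-w_*\|^2}{(1-c)^2\rho^2k^2}.$$ Computing $\tilde w_k$ takes exactly $k$ gradient calls. Hence, for every $\varepsilon>0$, if $k\ge\frac{\sqrt{2c_0}}{1-c}\cdot\frac{L^{1/2}\|\tilde z_0-w_*\|}{\rho\,\varepsilon^{1/2}}$ then $f(\tilde w_k)-f(w_*)\le\varepsilon$ with probability at least $1-\frac1{c^2k}-\frac1{c_0}$, so that $O\!\left(\frac{L^{1/2}\|\tilde z_0-w_*\|}{\rho\,\varepsilon^{1/2}}\right)$ gradient calls suffice. -/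

import Mathlib

open MeasureTheory ProbabilityTheory

/-- `f` is `L`-smooth: it is differentiable and has the quadratic upper bound with constant `L > 0`
at every point. -/
structure IsLSmooth {d : ℕ} (L : ℝ) (f : EuclideanSpace ℝ (Fin d) → ℝ) : Prop where
  pos : 0 < L
  differentiable : Differentiable ℝ f
  upper_bound : ∀ x y, f x ≤ f y + inner ℝ (gradient f y) (x - y) + L / 2 * ‖x - y‖ ^ 2

/-- `f` is `ρ`-quasar convex with respect to its global minimizer `wstar`. -/
structure IsQuasarConvex {d : ℕ} (ρ : ℝ) (f : EuclideanSpace ℝ (Fin d) → ℝ)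
    (wstar : EuclideanSpace ℝ (Fin d)) : Prop where
  pos : 0 < ρ
  minimizer : ∀ w, f wstar ≤ f w
  quasar : ∀ w, f w + 1 / ρ * inner ℝ (gradient f w) (wstar - w) ≤ f wstar

/-- `0 = T 0, T 1, T 2, …` are the successive event times of a rate one Poisson process:
the increments `T (k + 1) - T k` are i.i.d. exponential random variables with mean `1`. -/
structure IsPoissonTimes {Ω : Type*} [MeasurableSpace Ω] (P : Measure Ω) (T : ℕ → Ω → ℝ) :
    Prop where
  zero : ∀ ω, T 0 ω = 0
  law : ∀ k, HasLaw (fun ω => T (k + 1) ω - T k ω) (expMeasure 1) P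
  indep : iIndepFun (fun k ω => T (k + 1) ω - T k ω) P

/-- State of the discrete algorithm: the two iterates and the number of gradient
oracle calls made so far. -/
structure NesterovState (d : ℕ) where
  w : EuclideanSpace ℝ (Fin d)
  z : EuclideanSpace ℝ (Fin d)
  calls : ℕ

/-- One iteration with gradient oracle `g`:
`v = w + τ (z - w)`, `w⁺ = v - γ g(v)`, `z⁺ = z + τ' (v - z) - γ' g(v)`.
The oracle is queried once, at `v`. -/
noncomputable def nesterovStep {d : ℕ} (g : EuclideanSpace ℝ (Fin d) → EuclideanSpace ℝ (Fin d))
    (τ τ' γ γ' : ℝ) (s : NesterovState d) : NesterovState d :=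
  let v := s.w + τ • (s.z - s.w)
  let G := g v
  { w := v - γ • G
    z := s.z + τ' • (v - s.z) - γ' • G
    calls := s.calls + 1 }

/-- The discrete algorithm started at `(w₀, z₀)`. Iteration `k` (from step `k` to step `k + 1`)
uses `τ k`, `τ' k`, `γ (k + 1)` and `γ' (k + 1)`. -/
noncomputable def nesterovRun {d : ℕ} (g : EuclideanSpace ℝ (Fin d) → EuclideanSpace ℝ (Fin d))
    (τ τ' γ γ' : ℕ → ℝ) (w₀ z₀ : EuclideanSpace ℝ (Fin d)) : ℕ → NesterovState d
  | 0 => { w := w₀, z := z₀, calls := 0 }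
  | k + 1 => nesterovStep g (τ k) (τ' k) (γ (k + 1)) (γ' (k + 1))
      (nesterovRun g τ τ' γ γ' w₀ z₀ k)

/-- The discrete algorithm applied to `f` with the parameters for `L`-smooth, `ρ`-quasar convex
functions, along a realization `t 0, t 1, …` of the random times:
`τ k = 1 - (t k / t (k + 1)) ^ (2 / ρ)`, `τ' k = 0`, `γ k = 1 / L`, `γ' k = ρ t k / (2 L)`. -/
noncomputable def quasarRun {d : ℕ} (f : EuclideanSpace ℝ (Fin d) → ℝ) (L ρ : ℝ) (t : ℕ → ℝ)
    (w₀ z₀ : EuclideanSpace ℝ (Fin d)) : ℕ → NesterovState d :=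
  nesterovRun (gradient f)
    (fun k => 1 - (t k / t (k + 1)) ^ (2 / ρ))
    (fun _ => 0)
    (fun _ => 1 / L)
    (fun k => ρ * t k / (2 * L))
    w₀ z₀

/-! The points `v_k` are samples, at the event times of a Poisson process, of the flow `w' = 2 / (ρ
t) (z - w)` with `z` frozen, and the energy is `ρ² t² (f w - f wstar) / (4 L) + ‖z - wstar‖² / 2`.
Let `h t` be the energy along the flow. By smoothness and quasar convexity, a gradient step at time
`t` lowers the energy by at least `h' t`: the cross term `⟨∇f v, z - v⟩` and the growth of `t²`
produced by the flow are what the step pays back.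

The waiting time has density `exp (-e)`, and `exp (-e) (h - h') = -(exp (-e) h)'`, so the expected
energy after a step is at most the energy before it. As the waiting time is independent of the past,
the expected energy never exceeds its initial value `‖z₀ - wstar‖² / 2`.

Markov's inequality bounds the energy at step `k`, Chebyshev's inequality gives `T k > (1 - c) k`,
and a union bound combines them. -/

/-! ### Energy along the flow and across a gradient step. -/

section Deterministic

open Set Filter Topology

variable {d : ℕ} {f : EuclideanSpace ℝ (Fin d) → ℝ} {L ρ : ℝ}
  {wstar : EuclideanSpace ℝ (Fin d)}

/-- One gradient step of length `1 / L` on an `L`-smooth function decreases it by at least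
`‖∇f‖² / (2L)`. -/
lemma IsLSmooth.gradient_step_le (hf : IsLSmooth L f) (v : EuclideanSpace ℝ (Fin d)) :
    f (v - (1 / L) • gradient f v) ≤ f v - 1 / (2 * L) * ‖gradient f v‖ ^ 2 := by
  have h := hf.upper_bound (v - (1 / L) • gradient f v) v
  have hL := hf.pos
  have e : v - (1 / L) • gradient f v - v = -((1 / L) • gradient f v) := by abel
  rw [e, inner_neg_right, real_inner_smul_right, real_inner_self_eq_norm_sq, norm_neg, norm_smul,
    mul_pow, Real.norm_eq_abs, sq_abs] at h
  refine h.trans (le_of_eq ?_)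
  field_simp
  ring

/-- The Lyapunov function of the continuized Nesterov method. -/
noncomputable def nesterovEnergy (f : EuclideanSpace ℝ (Fin d) → ℝ) (L ρ : ℝ)
    (wstar : EuclideanSpace ℝ (Fin d)) (t : ℝ) (w z : EuclideanSpace ℝ (Fin d)) : ℝ :=
  ρ ^ 2 / (4 * L) * t ^ 2 * (f w - f wstar) + 1 / 2 * ‖z - wstar‖ ^ 2

/-- The mixing path between two gradient steps: position at time `t` of the flow
`w' = 2 / (ρ t) (z - w)` that starts at `w` at time `s`. -/
noncomputable def mixingPath (ρ s : ℝ) (w z : EuclideanSpace ℝ (Fin d)) (t : ℝ) :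
    EuclideanSpace ℝ (Fin d) :=
  w + (1 - (s / t) ^ (2 / ρ)) • (z - w)

lemma nesterovEnergy_nonneg (hL : 0 < L) (hq : IsQuasarConvex ρ f wstar) (t : ℝ)
    (w z : EuclideanSpace ℝ (Fin d)) : 0 ≤ nesterovEnergy f L ρ wstar t w z := by
  have := hq.minimizer w
  have : 0 ≤ f w - f wstar := by linarith
  unfold nesterovEnergy
  positivity

/-- Effect of a gradient step at time `t` on the energy. -/
lemma nesterovEnergy_jump_le (hf : IsLSmooth L f) (hq : IsQuasarConvex ρ f wstar) {t : ℝ}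
    (ht : 0 ≤ t) (v z : EuclideanSpace ℝ (Fin d)) :
    nesterovEnergy f L ρ wstar t (v - (1 / L) • gradient f v)
        (z - (ρ * t / (2 * L)) • gradient f v) ≤
      nesterovEnergy f L ρ wstar t v z - ρ ^ 2 / (4 * L) * (2 * t) * (f v - f wstar)
        - ρ * t / (2 * L) * inner ℝ (gradient f v) (z - v) := by
  have hL := hf.pos
  have hρ := hq.pos
  have h1 := hf.gradient_step_le v
  have h2 := hq.quasar v
  have h3 : ρ * (f v - f wstar) ≤ inner ℝ (gradient f v) (v - wstar) := by
    have e : inner ℝ (gradient f v) (wstar - v) = - inner ℝ (gradient f v) (v - wstar) := by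
      rw [← inner_neg_right, neg_sub]
    rw [e] at h2
    have : ρ * (f v + 1 / ρ * -inner ℝ (gradient f v) (v - wstar)) ≤ ρ * f wstar := by gcongr
    have e2 : ρ * (f v + 1 / ρ * -inner ℝ (gradient f v) (v - wstar)) =
      ρ * f v - inner ℝ (gradient f v) (v - wstar) := by field_simp; ring
    linarith
  have h4 : ‖z - (ρ * t / (2 * L)) • gradient f v - wstar‖ ^ 2 =
      ‖z - wstar‖ ^ 2 - 2 * (ρ * t / (2 * L)) *
        (inner ℝ (gradient f v) (z - v) + inner ℝ (gradient f v) (v - wstar))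
        + (ρ * t / (2 * L)) ^ 2 * ‖gradient f v‖ ^ 2 := by
    rw [← inner_add_right, sub_add_sub_cancel, sub_right_comm, norm_sub_sq_real,
      real_inner_smul_right, real_inner_comm, norm_smul, mul_pow, Real.norm_eq_abs, sq_abs]
    ring
  unfold nesterovEnergy
  rw [h4]
  have h5 := mul_le_mul_of_nonneg_left h1 (show 0 ≤ ρ ^ 2 / (4 * L) * t ^ 2 by positivity)
  have h6 := mul_le_mul_of_nonneg_left h3 (show 0 ≤ ρ * t / (2 * L) by positivity)
  -- The step size `ρ t / (2 L)` makes the decrease of `f` cancel exactly the `‖∇f‖²` term from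
  -- expanding `‖z - wstar‖²`.
  have e1 : ρ ^ 2 / (4 * L) * t ^ 2 * (f v - 1 / (2 * L) * ‖gradient f v‖ ^ 2) =
    ρ ^ 2 / (4 * L) * t ^ 2 * f v - 1 / 2 * (ρ * t / (2 * L)) ^ 2 * ‖gradient f v‖ ^ 2 := by
    field_simp; ring
  have e2 : ρ * t / (2 * L) * (ρ * (f v - f wstar)) =
    ρ ^ 2 / (4 * L) * (2 * t) * (f v - f wstar) := by
    field_simp; ring
  linarith

lemma mixingPath_self {s : ℝ} (hs : s ≠ 0) (w z : EuclideanSpace ℝ (Fin d)) :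
    mixingPath ρ s w z s = w := by
  simp [mixingPath, div_self hs]

/-- The flow is singular at time `0` and jumps to `z` at once. This also holds at `t = 0`, because
`0 / 0 = 0`. -/
lemma mixingPath_zero (hρ : 0 < ρ) (w z : EuclideanSpace ℝ (Fin d)) (t : ℝ) :
    mixingPath ρ 0 w z t = z := by
  have : (2 / ρ) ≠ 0 := by positivity
  simp [mixingPath, Real.zero_rpow this]

lemma hasDerivAt_mixingPath (hρ : 0 < ρ) {s t : ℝ} (hs : 0 ≤ s) (ht : 0 < t)
    (w z : EuclideanSpace ℝ (Fin d)) :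
    HasDerivAt (mixingPath ρ s w z) ((2 / (ρ * t)) • (z - mixingPath ρ s w z t)) t := by
  rcases hs.eq_or_lt with rfl | hs
  · have : mixingPath ρ 0 w z = fun _ => z := funext (mixingPath_zero hρ w z)
    rw [this]
    simpa using hasDerivAt_const t z
  · have hst : 0 < s / t := by positivity
    have h1 : HasDerivAt (fun t : ℝ => s / t) (-s / t ^ 2) t := by
      simpa [div_eq_mul_inv, neg_mul, mul_neg] using (hasDerivAt_inv ht.ne').const_mul s
    have h2 := ((h1.rpow_const (p := 2 / ρ) (Or.inl hst.ne')).const_sub 1).smul_const (z - w)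
    have h3 := h2.const_add w
    refine h3.congr_deriv ?_
    have e : z - mixingPath ρ s w z t = ((s / t) ^ (2 / ρ)) • (z - w) := by
      simp only [mixingPath]; module
    rw [e, smul_smul, Real.rpow_sub_one hst.ne']
    congr 1
    field_simp

/-- The value of a differentiable function along the mixing path. -/
lemma hasDerivAt_comp_mixingPath (hf : IsLSmooth L f) (hρ : 0 < ρ) {s t : ℝ} (hs : 0 ≤ s)
    (ht : 0 < t) (w z : EuclideanSpace ℝ (Fin d)) :
    HasDerivAt (fun t => f (mixingPath ρ s w z t))
      (2 / (ρ * t) * inner ℝ (gradient f (mixingPath ρ s w z t)) (z - mixingPath ρ s w z t)) t := by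
  have h := (hf.differentiable (mixingPath ρ s w z t)).hasGradientAt.hasFDerivAt.comp_hasDerivAt t
    (hasDerivAt_mixingPath hρ hs ht w z)
  refine h.congr_deriv ?_
  rw [map_smul, smul_eq_mul, InnerProductSpace.toDual_apply_apply]

/-- The energy along the mixing path. -/
lemma hasDerivAt_nesterovEnergy_mixingPath (hf : IsLSmooth L f) (hρ : 0 < ρ) {s t : ℝ}
    (hs : 0 ≤ s) (ht : 0 < t) (w z : EuclideanSpace ℝ (Fin d)) :
    HasDerivAt (fun t => nesterovEnergy f L ρ wstar t (mixingPath ρ s w z t) z)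
      (ρ ^ 2 / (4 * L) * (2 * t) * (f (mixingPath ρ s w z t) - f wstar)
        + ρ * t / (2 * L) *
          inner ℝ (gradient f (mixingPath ρ s w z t)) (z - mixingPath ρ s w z t)) t := by
  have hL := hf.pos
  have h1 := ((hasDerivAt_pow 2 t).const_mul (ρ ^ 2 / (4 * L))).mul
    ((hasDerivAt_comp_mixingPath hf hρ hs ht w z).sub_const (f wstar))
  refine (h1.add_const (1 / 2 * ‖z - wstar‖ ^ 2)).congr_deriv ?_
  push_cast
  field_simp
  ring

/-- The energy after one iteration, as a function of the previous state and of the time `e`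
elapsed since the previous gradient step. -/
noncomputable def energyAfterStep (f : EuclideanSpace ℝ (Fin d) → ℝ) (L ρ : ℝ)
    (wstar : EuclideanSpace ℝ (Fin d)) (s : ℝ) (w z : EuclideanSpace ℝ (Fin d)) (e : ℝ) : ℝ :=
  nesterovEnergy f L ρ wstar (s + e)
    (mixingPath ρ s w z (s + e) - (1 / L) • gradient f (mixingPath ρ s w z (s + e)))
    (z - (ρ * (s + e) / (2 * L)) • gradient f (mixingPath ρ s w z (s + e)))

/-- The expected energy does not increase over one iteration. -/
lemma lintegral_exp_mul_energyAfterStep_le (hf : IsLSmooth L f) (hq : IsQuasarConvex ρ f wstar)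
    {s : ℝ} (hs : 0 ≤ s) (w z : EuclideanSpace ℝ (Fin d)) :
    ∫⁻ e in Ioi 0, ENNReal.ofReal (Real.exp (-e) * energyAfterStep f L ρ wstar s w z e) ≤
      ENNReal.ofReal (nesterovEnergy f L ρ wstar s w z) := by
  have hL := hf.pos
  have hρ := hq.pos
  set h : ℝ → ℝ := fun t => nesterovEnergy f L ρ wstar t (mixingPath ρ s w z t) z with hh
  set h' : ℝ → ℝ := fun t => ρ ^ 2 / (4 * L) * (2 * t) * (f (mixingPath ρ s w z t) - f wstar)
        + ρ * t / (2 * L) *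
          inner ℝ (gradient f (mixingPath ρ s w z t)) (z - mixingPath ρ s w z t) with hh'
  have hder : ∀ t, 0 < t → HasDerivAt h (h' t) t := fun t ht =>
    hasDerivAt_nesterovEnergy_mixingPath hf hρ hs ht w z
  have hnn : ∀ t, 0 ≤ h t := fun t => nesterovEnergy_nonneg hL hq _ _ _
  have hstart : h s = nesterovEnergy f L ρ wstar s w z := by
    -- At `s = 0` the path starts at `z` rather than `w`, but the factor `t²` removes the `f` term.
    rcases hs.eq_or_lt with rfl | hs
    · simp [hh, nesterovEnergy]
    · simp [hh, mixingPath_self hs.ne']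
  have hjump : ∀ e, 0 < e → energyAfterStep f L ρ wstar s w z e ≤ h (s + e) - h' (s + e) := by
    intro e he
    have := nesterovEnergy_jump_le hf hq (show 0 ≤ s + e by positivity)
      (mixingPath ρ s w z (s + e)) z
    simp only [hh, hh', energyAfterStep]
    linarith
  set g : ℝ → ℝ := fun e => -(Real.exp (-e) * h (s + e)) with hg
  set g' : ℝ → ℝ := fun e => Real.exp (-e) * (h (s + e) - h' (s + e)) with hg'
  have hgder : ∀ e ∈ Ioi (0 : ℝ), HasDerivAt g (g' e) e := by
    intro e he
    have he : 0 < e := he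
    have h1 : HasDerivAt (fun e => h (s + e)) (h' (s + e)) e := by
      simpa using (hder (s + e) (by positivity)).comp_const_add s e
    have h2 : HasDerivAt (fun e : ℝ => Real.exp (-e)) (-Real.exp (-e)) e := by
      simpa using (hasDerivAt_neg e).exp
    refine (h2.mul h1).neg.congr_deriv ?_
    simp only [hg']; ring
  -- `h - h'` dominates the energy after the step, which is nonnegative.
  have hg'nn : ∀ e ∈ Ioi (0 : ℝ), 0 ≤ g' e := fun e he =>
    mul_nonneg (Real.exp_pos _).le
      ((nesterovEnergy_nonneg hL hq _ _ _).trans (hjump e he))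
  have hcont_h : ContinuousAt h s := by
    rcases hs.eq_or_lt with rfl | hs
    · have : h = fun t => nesterovEnergy f L ρ wstar t z z := by
        funext t; simp [hh, mixingPath_zero hρ]
      rw [this]
      unfold nesterovEnergy
      fun_prop
    · exact (hder s hs).continuousAt
  have hcont : ContinuousWithinAt g (Ici 0) 0 := by
    have h1 : ContinuousAt (fun e => h (s + e)) 0 :=
      ContinuousAt.comp (f := fun e : ℝ => s + e) (g := h) (by simpa using hcont_h)
        (by fun_prop)
    have h2 : ContinuousAt (fun e : ℝ => Real.exp (-e)) 0 := by fun_prop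
    have : ContinuousAt g 0 := (h2.mul h1).neg
    exact this.continuousWithinAt
  have hmono : MonotoneOn g (Ici 0) := by
    refine monotoneOn_of_deriv_nonneg (convex_Ici 0) ?_ ?_ ?_
    · intro e he
      rcases (show (0 : ℝ) ≤ e from he).eq_or_lt with rfl | he
      · exact hcont
      · exact (hgder e he).continuousAt.continuousWithinAt
    · rw [interior_Ici]
      exact fun e he => (hgder e he).differentiableAt.differentiableWithinAt
    · rw [interior_Ici]
      exact fun e he => (hgder e he).deriv ▸ hg'nn e he
  have hle : ∀ e, g e ≤ 0 := fun e =>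
    neg_nonpos.2 (mul_nonneg (Real.exp_pos _).le (hnn _))
  -- Monotonicity and the bound `g ≤ 0` give a limit, hence integrability of `g'`, with no growth
  -- assumption on `f`.
  obtain ⟨l, hl⟩ : ∃ l, Tendsto g atTop (𝓝 l) := by
    have hm : Monotone fun e => g (max e 0) := fun a b hab =>
      hmono (le_max_right a 0) (le_max_right b 0) (max_le_max_right _ hab)
    refine ⟨_, (tendsto_atTop_ciSup hm ⟨0, ?_⟩).congr' ?_⟩
    · rintro _ ⟨e, rfl⟩
      exact hle _
    · filter_upwards [eventually_ge_atTop 0] with e he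
      rw [max_eq_left he]
  have hl0 : l ≤ 0 := le_of_tendsto hl (Eventually.of_forall hle)
  have hint := integrableOn_Ioi_deriv_of_nonneg hcont hgder hg'nn hl
  have hval := integral_Ioi_of_hasDerivAt_of_nonneg hcont hgder hg'nn hl
  calc ∫⁻ e in Ioi 0, ENNReal.ofReal (Real.exp (-e) * energyAfterStep f L ρ wstar s w z e)
      ≤ ∫⁻ e in Ioi 0, ENNReal.ofReal (g' e) := by
        refine setLIntegral_mono' measurableSet_Ioi fun e he => ENNReal.ofReal_le_ofReal ?_
        exact mul_le_mul_of_nonneg_left (hjump e he) (Real.exp_pos _).le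
    _ = ENNReal.ofReal (∫ e in Ioi 0, g' e) := by
        rw [ofReal_integral_eq_lintegral_ofReal hint]
        exact (ae_restrict_iff' measurableSet_Ioi).2 (Eventually.of_forall hg'nn)
    _ ≤ ENNReal.ofReal (nesterovEnergy f L ρ wstar s w z) := by
        refine ENNReal.ofReal_le_ofReal ?_
        -- The integral is `l - g 0 = l + h s`, with `l ≤ 0`.
        rw [hval, ← hstart]
        simp [hg, hl0]

end Deterministic

/-! ### Moments of the exponential law. -/

section Exponential

open Set

lemma expMeasure_one_eq_withDensity :
    expMeasure 1 =
      (volume.restrict (Ioi 0)).withDensity (fun x => ENNReal.ofReal (Real.exp (-x))) := by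
  rw [Measure.restrict_congr_set Ioi_ae_eq_Ici, ← withDensity_indicator measurableSet_Ici]
  change volume.withDensity (exponentialPDF 1) = _
  congr 1
  funext x
  rw [exponentialPDF_eq]
  by_cases hx : 0 ≤ x <;> simp [indicator, hx]

lemma lintegral_expMeasure_one {g : ℝ → ENNReal} (hg : Measurable g) :
    ∫⁻ x, g x ∂(expMeasure 1) = ∫⁻ x in Ioi 0, ENNReal.ofReal (Real.exp (-x)) * g x := by
  rw [expMeasure_one_eq_withDensity, lintegral_withDensity_eq_lintegral_mul _ (by fun_prop) hg]
  rfl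

lemma ae_expMeasure_one_pos : ∀ᵐ x ∂(expMeasure 1), 0 < x := by
  rw [expMeasure_one_eq_withDensity]
  exact withDensity_absolutelyContinuous _ _ (ae_restrict_mem measurableSet_Ioi)

lemma integrable_pow_expMeasure_one (n : ℕ) : Integrable (fun x => x ^ n) (expMeasure 1) := by
  rw [expMeasure_one_eq_withDensity,
    integrable_withDensity_iff (by fun_prop) (by simp)]
  refine (Real.GammaIntegral_convergent (s := n + 1) (by positivity)).congr ?_
  refine Filter.Eventually.of_forall fun x => ?_
  simp [ENNReal.toReal_ofReal (Real.exp_pos _).le, mul_comm]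

lemma integral_pow_expMeasure_one (n : ℕ) : ∫ x, x ^ n ∂(expMeasure 1) = n.factorial := by
  rw [expMeasure_one_eq_withDensity,
    integral_withDensity_eq_integral_toReal_smul (by fun_prop) (by simp),
    ← Real.Gamma_nat_eq_factorial, Real.Gamma_eq_integral (by positivity)]
  refine integral_congr_ae (Filter.Eventually.of_forall fun x => ?_)
  simp [ENNReal.toReal_ofReal (Real.exp_pos _).le]

lemma variance_id_expMeasure_one : Var[id; expMeasure 1] = 1 := by
  have := isProbabilityMeasure_expMeasure one_pos
  have hmem : MemLp id 2 (expMeasure 1) :=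
    (memLp_two_iff_integrable_sq (by fun_prop)).2 (integrable_pow_expMeasure_one 2)
  rw [variance_eq_sub hmem]
  have h1 := integral_pow_expMeasure_one 1
  have h2 := integral_pow_expMeasure_one 2
  simp only [pow_one] at h1
  simp [h1, h2, Nat.factorial]
  norm_num

end Exponential

/-! ### Mean, variance and lower tail of the event times. -/

section PoissonTimes

variable {Ω : Type*} [MeasurableSpace Ω] {P : Measure Ω} {T : ℕ → Ω → ℝ}

lemma IsPoissonTimes.eq_sum (hT : IsPoissonTimes P T) (k : ℕ) :
    T k = ∑ i ∈ Finset.range k, fun ω => T (i + 1) ω - T i ω := by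
  funext ω
  rw [Finset.sum_apply, Finset.sum_range_sub (fun i => T i ω), hT.zero, sub_zero]

lemma IsPoissonTimes.memLp_increment (hT : IsPoissonTimes P T) (k : ℕ) :
    MemLp (fun ω => T (k + 1) ω - T k ω) 2 P := by
  have : MemLp id 2 (P.map (fun ω => T (k + 1) ω - T k ω)) := by
    rw [(hT.law k).map_eq]
    exact (memLp_two_iff_integrable_sq (by fun_prop)).2 (integrable_pow_expMeasure_one 2)
  exact (memLp_map_measure_iff (by fun_prop) (hT.law k).aemeasurable).1 this

lemma IsPoissonTimes.ae_nonneg (hT : IsPoissonTimes P T) (k : ℕ) : ∀ᵐ ω ∂P, 0 ≤ T k ω := by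
  have h : ∀ᵐ ω ∂P, ∀ i, 0 < T (i + 1) ω - T i ω := ae_all_iff.2 fun i =>
    ((hT.law i).ae_iff (p := fun x => 0 < x) (by fun_prop)).2 ae_expMeasure_one_pos
  filter_upwards [h] with ω hω
  rw [hT.eq_sum, Finset.sum_apply]
  exact Finset.sum_nonneg fun i _ => (hω i).le

lemma IsPoissonTimes.memLp (hT : IsPoissonTimes P T) (k : ℕ) : MemLp (T k) 2 P := by
  rw [hT.eq_sum]
  exact memLp_finsetSum' _ fun i _ => hT.memLp_increment i

lemma IsPoissonTimes.integral_eq [IsProbabilityMeasure P] (hT : IsPoissonTimes P T) (k : ℕ) : ∫ ω, T k ω ∂P = k := by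
  have h1 : ∀ i, ∫ ω, (T (i + 1) ω - T i ω) ∂P = 1 := fun i => by
    rw [(hT.law i).integral_eq]
    simpa using integral_pow_expMeasure_one 1
  rw [hT.eq_sum]
  simp only [Finset.sum_apply]
  rw [integral_finsetSum _ fun i _ => (hT.memLp_increment i).integrable (by norm_num)]
  simp [h1]

lemma IsPoissonTimes.variance_eq (hT : IsPoissonTimes P T) (k : ℕ) : Var[T k; P] = k := by
  rw [hT.eq_sum, IndepFun.variance_sum (fun i _ => hT.memLp_increment i)
    (fun i _ j _ hij => hT.indep.indepFun hij)]
  simp [(hT.law _).variance_eq, variance_id_expMeasure_one]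

/-- Chebyshev's inequality for the lower tail of the `k`-th event time. -/
lemma IsPoissonTimes.measureReal_le [IsProbabilityMeasure P] (hT : IsPoissonTimes P T) {c : ℝ}
    (hc : 0 < c) {k : ℕ} (hk : 1 ≤ k) : P.real {ω | T k ω ≤ (1 - c) * k} ≤ 1 / (c ^ 2 * k) := by
  have hk0 : (0 : ℝ) < k := by exact_mod_cast hk
  have h := meas_ge_le_variance_div_sq (hT.memLp k) (show 0 < c * k by positivity)
  rw [hT.variance_eq, hT.integral_eq] at h
  have hsub : {ω | T k ω ≤ (1 - c) * k} ⊆ {ω | c * k ≤ |T k ω - k|} := by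
    intro ω hω
    have hω : T k ω ≤ (1 - c) * k := hω
    change c * k ≤ |T k ω - k|
    rw [abs_sub_comm]
    exact le_trans (by linarith) (le_abs_self _)
  have e : (k : ℝ) / (c * k) ^ 2 = 1 / (c ^ 2 * k) := by field_simp
  rw [e] at h
  exact ENNReal.toReal_le_of_le_ofReal (by positivity) ((measure_mono hsub).trans h)

end PoissonTimes

/-! ### The algorithm as a Markov chain, and its expected energy. -/

section TimedState

variable {d : ℕ} {f : EuclideanSpace ℝ (Fin d) → ℝ} {L ρ : ℝ}
  {wstar : EuclideanSpace ℝ (Fin d)}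

/-- One iteration as a map of (time, first iterate, second iterate) and the elapsed time. -/
noncomputable def timedStep (f : EuclideanSpace ℝ (Fin d) → ℝ) (L ρ : ℝ)
    (x : ℝ × EuclideanSpace ℝ (Fin d) × EuclideanSpace ℝ (Fin d)) (e : ℝ) :
    ℝ × EuclideanSpace ℝ (Fin d) × EuclideanSpace ℝ (Fin d) :=
  (x.1 + e,
    mixingPath ρ x.1 x.2.1 x.2.2 (x.1 + e) -
      (1 / L) • gradient f (mixingPath ρ x.1 x.2.1 x.2.2 (x.1 + e)),
    x.2.2 - (ρ * (x.1 + e) / (2 * L)) • gradient f (mixingPath ρ x.1 x.2.1 x.2.2 (x.1 + e)))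

lemma measurable_gradient (f : EuclideanSpace ℝ (Fin d) → ℝ) : Measurable (gradient f) :=
  (InnerProductSpace.toDual ℝ (EuclideanSpace ℝ (Fin d))).symm.continuous.measurable.comp
    (measurable_fderiv ℝ f)

lemma measurable_timedStep (f : EuclideanSpace ℝ (Fin d) → ℝ) (L ρ : ℝ) :
    Measurable (fun p : (ℝ × EuclideanSpace ℝ (Fin d) × EuclideanSpace ℝ (Fin d)) × ℝ =>
      timedStep f L ρ p.1 p.2) := by
  have hg := measurable_gradient f
  unfold timedStep mixingPath
  fun_prop

lemma measurable_nesterovEnergy (hf : IsLSmooth L f) :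
    Measurable (fun x : ℝ × EuclideanSpace ℝ (Fin d) × EuclideanSpace ℝ (Fin d) =>
      nesterovEnergy f L ρ wstar x.1 x.2.1 x.2.2) := by
  have hc := hf.differentiable.continuous.measurable
  unfold nesterovEnergy
  fun_prop

lemma energyAfterStep_eq (x : ℝ × EuclideanSpace ℝ (Fin d) × EuclideanSpace ℝ (Fin d)) (e : ℝ) :
    energyAfterStep f L ρ wstar x.1 x.2.1 x.2.2 e =
      nesterovEnergy f L ρ wstar (timedStep f L ρ x e).1 (timedStep f L ρ x e).2.1
        (timedStep f L ρ x e).2.2 := rfl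

lemma measurable_energyAfterStep (hf : IsLSmooth L f) :
    Measurable (fun p : (ℝ × EuclideanSpace ℝ (Fin d) × EuclideanSpace ℝ (Fin d)) × ℝ =>
      energyAfterStep f L ρ wstar p.1.1 p.1.2.1 p.1.2.2 p.2) := by
  simp only [energyAfterStep_eq]
  exact (measurable_nesterovEnergy hf).comp (measurable_timedStep f L ρ)

lemma lintegral_expMeasure_energyAfterStep_le (hf : IsLSmooth L f) (hq : IsQuasarConvex ρ f wstar)
    {s : ℝ} (hs : 0 ≤ s) (w z : EuclideanSpace ℝ (Fin d)) :
    ∫⁻ e, ENNReal.ofReal (energyAfterStep f L ρ wstar s w z e) ∂(expMeasure 1) ≤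
      ENNReal.ofReal (nesterovEnergy f L ρ wstar s w z) := by
  have h : Measurable fun e => energyAfterStep f L ρ wstar s w z e :=
    (measurable_energyAfterStep hf).comp (measurable_prodMk_left (x := (s, w, z)))
  rw [lintegral_expMeasure_one h.ennreal_ofReal]
  simp_rw [← ENNReal.ofReal_mul (Real.exp_pos _).le]
  exact lintegral_exp_mul_energyAfterStep_le hf hq hs w z

variable {Ω : Type*}

/-- Event time and iterates of the algorithm after `k` iterations. -/
noncomputable def timedState (f : EuclideanSpace ℝ (Fin d) → ℝ) (L ρ : ℝ)
    (w₀ z₀ : EuclideanSpace ℝ (Fin d)) (T : ℕ → Ω → ℝ) (k : ℕ) (ω : Ω) :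
    ℝ × EuclideanSpace ℝ (Fin d) × EuclideanSpace ℝ (Fin d) :=
  (T k ω, (quasarRun f L ρ (fun i => T i ω) w₀ z₀ k).w,
    (quasarRun f L ρ (fun i => T i ω) w₀ z₀ k).z)

lemma timedState_succ (w₀ z₀ : EuclideanSpace ℝ (Fin d)) (T : ℕ → Ω → ℝ) (k : ℕ) (ω : Ω) :
    timedState f L ρ w₀ z₀ T (k + 1) ω =
      timedStep f L ρ (timedState f L ρ w₀ z₀ T k ω) (T (k + 1) ω - T k ω) := by
  simp [timedState, timedStep, quasarRun, nesterovRun, nesterovStep, mixingPath]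

lemma quasarRun_calls (t : ℕ → ℝ) (w₀ z₀ : EuclideanSpace ℝ (Fin d)) (k : ℕ) :
    (quasarRun f L ρ t w₀ z₀ k).calls = k := by
  induction k with
  | zero => rfl
  | succ k ih => exact congrArg (· + 1) ih

variable [MeasurableSpace Ω] {P : Measure Ω} {T : ℕ → Ω → ℝ}

/-- The state after `k` iterations is a measurable function of the first `k` waiting times. -/
lemma IsPoissonTimes.exists_timedState_eq (hT : IsPoissonTimes P T)
    (w₀ z₀ : EuclideanSpace ℝ (Fin d)) (k : ℕ) :
    ∃ ψ : (Finset.range k → ℝ) → ℝ × EuclideanSpace ℝ (Fin d) × EuclideanSpace ℝ (Fin d),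
      Measurable ψ ∧ ∀ ω, timedState f L ρ w₀ z₀ T k ω =
        ψ (fun i => T (i + 1) ω - T i ω) := by
  induction k with
  | zero =>
    refine ⟨fun _ => (0, w₀, z₀), measurable_const, fun ω => ?_⟩
    simp [timedState, hT.zero, quasarRun, nesterovRun]
  | succ k ih =>
    obtain ⟨ψ, hψ, h⟩ := ih
    refine ⟨fun x => timedStep f L ρ
      (ψ fun i => x ⟨i, Finset.mem_range.2 ((Finset.mem_range.1 i.2).trans k.lt_succ_self)⟩)
      (x ⟨k, Finset.self_mem_range_succ k⟩), ?_, fun ω => ?_⟩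
    · exact (measurable_timedStep f L ρ).comp
        ((hψ.comp (by fun_prop)).prodMk (by fun_prop))
    · rw [timedState_succ, h]

lemma IsPoissonTimes.aemeasurable_timedState (hT : IsPoissonTimes P T)
    (w₀ z₀ : EuclideanSpace ℝ (Fin d)) (k : ℕ) :
    AEMeasurable (timedState f L ρ w₀ z₀ T k) P := by
  obtain ⟨ψ, hψ, h⟩ := hT.exists_timedState_eq (f := f) (L := L) (ρ := ρ) w₀ z₀ k
  rw [funext h]
  exact hψ.comp_aemeasurable (aemeasurable_pi_lambda _ fun i => (hT.law i).aemeasurable)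

/-- The state depends only on the increments of index below `k`, a set disjoint from `{k}`. -/
lemma IsPoissonTimes.indepFun_timedState (hT : IsPoissonTimes P T)
    (w₀ z₀ : EuclideanSpace ℝ (Fin d)) (k : ℕ) :
    IndepFun (timedState f L ρ w₀ z₀ T k) (fun ω => T (k + 1) ω - T k ω) P := by
  obtain ⟨ψ, hψ, h⟩ := hT.exists_timedState_eq (f := f) (L := L) (ρ := ρ) w₀ z₀ k
  have hi := hT.indep.indepFun_finset₀ (Finset.range k) {k} (by simp)
    fun i => (hT.law i).aemeasurable
  rw [funext h]
  have hk : Measurable fun x : ({k} : Finset ℕ) → ℝ => x ⟨k, Finset.mem_singleton_self k⟩ :=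
    measurable_pi_apply _
  exact hi.comp hψ hk

variable [IsProbabilityMeasure P]

/-- The energy of the algorithm decreases in expectation. -/
lemma IsPoissonTimes.lintegral_nesterovEnergy_succ_le (hT : IsPoissonTimes P T)
    (hf : IsLSmooth L f) (hq : IsQuasarConvex ρ f wstar)
    (w₀ z₀ : EuclideanSpace ℝ (Fin d)) (k : ℕ) :
    ∫⁻ ω, ENNReal.ofReal (nesterovEnergy f L ρ wstar (timedState f L ρ w₀ z₀ T (k + 1) ω).1
        (timedState f L ρ w₀ z₀ T (k + 1) ω).2.1 (timedState f L ρ w₀ z₀ T (k + 1) ω).2.2) ∂P ≤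
      ∫⁻ ω, ENNReal.ofReal (nesterovEnergy f L ρ wstar (timedState f L ρ w₀ z₀ T k ω).1
        (timedState f L ρ w₀ z₀ T k ω).2.1 (timedState f L ρ w₀ z₀ T k ω).2.2) ∂P := by
  have := isProbabilityMeasure_expMeasure one_pos
  set X := timedState f L ρ w₀ z₀ T k with hX
  have hXm : AEMeasurable X P := hT.aemeasurable_timedState w₀ z₀ k
  have hEm := (hT.law k).aemeasurable
  have hlaw := (hT.indepFun_timedState (f := f) (L := L) (ρ := ρ) w₀ z₀
    k).map_prod_eq_prod_map_map hXm hEm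
  rw [(hT.law k).map_eq] at hlaw
  have hmeas := (measurable_energyAfterStep (ρ := ρ) (wstar := wstar) hf).ennreal_ofReal
  -- The one-step bound needs a nonnegative time, which holds only almost surely.
  have hpos : ∀ᵐ x ∂(P.map X), 0 ≤ x.1 :=
    (ae_map_iff hXm (measurableSet_le measurable_const measurable_fst)).2 (hT.ae_nonneg k)
  calc ∫⁻ ω, ENNReal.ofReal (nesterovEnergy f L ρ wstar (timedState f L ρ w₀ z₀ T (k + 1) ω).1
        (timedState f L ρ w₀ z₀ T (k + 1) ω).2.1 (timedState f L ρ w₀ z₀ T (k + 1) ω).2.2) ∂P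
      = ∫⁻ ω, ENNReal.ofReal (energyAfterStep f L ρ wstar (X ω).1 (X ω).2.1 (X ω).2.2
          (T (k + 1) ω - T k ω)) ∂P := by
        simp only [timedState_succ, energyAfterStep_eq, hX]
    _ = ∫⁻ p, ENNReal.ofReal (energyAfterStep f L ρ wstar p.1.1 p.1.2.1 p.1.2.2 p.2)
          ∂((P.map X).prod (expMeasure 1)) := by
        rw [← hlaw, lintegral_map' hmeas.aemeasurable (hXm.prodMk hEm)]
    _ = ∫⁻ x, ∫⁻ e, ENNReal.ofReal (energyAfterStep f L ρ wstar x.1 x.2.1 x.2.2 e)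
          ∂(expMeasure 1) ∂(P.map X) := lintegral_prod _ hmeas.aemeasurable
    _ ≤ ∫⁻ x, ENNReal.ofReal (nesterovEnergy f L ρ wstar x.1 x.2.1 x.2.2) ∂(P.map X) := by
        refine lintegral_mono_ae ?_
        filter_upwards [hpos] with x hx
        exact lintegral_expMeasure_energyAfterStep_le hf hq hx x.2.1 x.2.2
    _ = ∫⁻ ω, ENNReal.ofReal (nesterovEnergy f L ρ wstar (X ω).1 (X ω).2.1 (X ω).2.2) ∂P :=
        lintegral_map' (measurable_nesterovEnergy hf).ennreal_ofReal.aemeasurable hXm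

lemma IsPoissonTimes.lintegral_nesterovEnergy_le (hT : IsPoissonTimes P T)
    (hf : IsLSmooth L f) (hq : IsQuasarConvex ρ f wstar)
    (w₀ z₀ : EuclideanSpace ℝ (Fin d)) (k : ℕ) :
    ∫⁻ ω, ENNReal.ofReal (nesterovEnergy f L ρ wstar (timedState f L ρ w₀ z₀ T k ω).1
        (timedState f L ρ w₀ z₀ T k ω).2.1 (timedState f L ρ w₀ z₀ T k ω).2.2) ∂P ≤
      ENNReal.ofReal (1 / 2 * ‖z₀ - wstar‖ ^ 2) := by
  induction k with
  | zero => simp [timedState, hT.zero, quasarRun, nesterovRun, nesterovEnergy]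
  | succ k ih => exact (hT.lintegral_nesterovEnergy_succ_le hf hq w₀ z₀ k).trans ih

end TimedState

/-! ### From expectation to high probability. -/

/-- Markov's inequality with a bound on the expectation that may vanish. -/
lemma measure_mul_lt_le_one_div {Ω : Type*} [MeasurableSpace Ω] {P : Measure Ω} {X : Ω → ℝ}
    (hX : AEMeasurable X P) {a c : ℝ} (ha : 0 ≤ a) (hc : 0 < c)
    (h : ∫⁻ ω, ENNReal.ofReal (X ω) ∂P ≤ ENNReal.ofReal a) :
    P {ω | c * a < X ω} ≤ ENNReal.ofReal (1 / c) := by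
  -- The case `a = 0` arises when `z₀ = wstar`; then `X ≤ 0` almost surely.
  rcases ha.eq_or_lt with rfl | ha
  · have h0 : ∫⁻ ω, ENNReal.ofReal (X ω) ∂P = 0 := by simpa using h
    rw [lintegral_eq_zero_iff' hX.ennreal_ofReal] at h0
    have : P {ω | c * 0 < X ω} = 0 := by
      rw [measure_eq_zero_iff_ae_notMem]
      filter_upwards [h0] with ω hω
      have : X ω ≤ 0 := by simpa using hω
      simpa using this
    rw [this]
    exact zero_le
  · have hca : 0 < c * a := by positivity
    calc P {ω | c * a < X ω} ≤ P {ω | ENNReal.ofReal (c * a) ≤ ENNReal.ofReal (X ω)} :=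
          measure_mono fun ω hω => ENNReal.ofReal_le_ofReal (le_of_lt hω)
      _ ≤ (∫⁻ ω, ENNReal.ofReal (X ω) ∂P) / ENNReal.ofReal (c * a) :=
          meas_ge_le_lintegral_div hX.ennreal_ofReal (by simpa using hca) (by simp)
      _ ≤ ENNReal.ofReal a / ENNReal.ofReal (c * a) := by gcongr
      _ = ENNReal.ofReal (1 / c) := by
          rw [← ENNReal.ofReal_div_of_pos hca]
          congr 1
          field_simp

theorem corollary1 {d : ℕ} {Ω : Type*} [MeasurableSpace Ω] (P : Measure Ω) [IsProbabilityMeasure P]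
    (T : ℕ → Ω → ℝ) (hT : IsPoissonTimes P T)
    (f : EuclideanSpace ℝ (Fin d) → ℝ) (L ρ : ℝ) (wstar w₀ z₀ : EuclideanSpace ℝ (Fin d))
    (hf : IsLSmooth L f) (hq : IsQuasarConvex ρ f wstar)
    (c c₀ : ℝ) (hc : 0 < c) (hc1 : c < 1) (hc₀ : 1 < c₀) (k : ℕ) (hk : 1 ≤ k) :
    -- high-probability bound on the optimality gap
    (1 - 1 / (c ^ 2 * (k : ℝ)) - 1 / c₀ ≤
      P.real {ω | f (quasarRun f L ρ (fun i => T i ω) w₀ z₀ k).w - f wstar ≤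
        2 * c₀ * L * ‖z₀ - wstar‖ ^ 2 / ((1 - c) ^ 2 * ρ ^ 2 * (k : ℝ) ^ 2)}) ∧
    -- `k` iterations make exactly `k` gradient calls
    (∀ ω, (quasarRun f L ρ (fun i => T i ω) w₀ z₀ k).calls = k) ∧
    -- resulting number of gradient calls that suffices for an `ε`-optimality gap
    (∀ ε : ℝ, 0 < ε →
      Real.sqrt (2 * c₀) / (1 - c) * (Real.sqrt L * ‖z₀ - wstar‖ / (ρ * Real.sqrt ε)) ≤ (k : ℝ) →
      1 - 1 / (c ^ 2 * (k : ℝ)) - 1 / c₀ ≤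
        P.real {ω | f (quasarRun f L ρ (fun i => T i ω) w₀ z₀ k).w - f wstar ≤ ε}) := by
  have hL := hf.pos
  have hρ := hq.pos
  have hk0 : (0 : ℝ) < k := by exact_mod_cast hk
  have hc' : 0 < 1 - c := by linarith
  have hc₀' : 0 < c₀ := by linarith
  have main : 1 - 1 / (c ^ 2 * (k : ℝ)) - 1 / c₀ ≤
      P.real {ω | f (quasarRun f L ρ (fun i => T i ω) w₀ z₀ k).w - f wstar ≤
        2 * c₀ * L * ‖z₀ - wstar‖ ^ 2 / ((1 - c) ^ 2 * ρ ^ 2 * (k : ℝ) ^ 2)} := by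
    set X : Ω → ℝ := fun ω => nesterovEnergy f L ρ wstar (timedState f L ρ w₀ z₀ T k ω).1
        (timedState f L ρ w₀ z₀ T k ω).2.1 (timedState f L ρ w₀ z₀ T k ω).2.2 with hX
    have hXm : AEMeasurable X P :=
      (measurable_nesterovEnergy hf).comp_aemeasurable (hT.aemeasurable_timedState w₀ z₀ k)
    have hA : P.real {ω | c₀ * (1 / 2 * ‖z₀ - wstar‖ ^ 2) < X ω} ≤ 1 / c₀ :=
      ENNReal.toReal_le_of_le_ofReal (by positivity)
        (measure_mul_lt_le_one_div hXm (by positivity) hc₀'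
          (hT.lintegral_nesterovEnergy_le hf hq w₀ z₀ k))
    have hB := hT.measureReal_le hc hk
    set G := {ω | f (quasarRun f L ρ (fun i => T i ω) w₀ z₀ k).w - f wstar ≤
        2 * c₀ * L * ‖z₀ - wstar‖ ^ 2 / ((1 - c) ^ 2 * ρ ^ 2 * (k : ℝ) ^ 2)} with hG
    -- Only this inclusion is used, so `G` need not be shown measurable.
    have hcover : Set.univ ⊆ G ∪ ({ω | T k ω ≤ (1 - c) * k} ∪
        {ω | c₀ * (1 / 2 * ‖z₀ - wstar‖ ^ 2) < X ω}) := by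
      intro ω _
      by_contra hω
      simp only [Set.mem_union, not_or, Set.mem_ofPred_eq, not_le, not_lt] at hω
      obtain ⟨h1, h2, h3⟩ := hω
      refine h1 ?_
      change f (quasarRun f L ρ (fun i => T i ω) w₀ z₀ k).w - f wstar ≤ _
      have h4 : ρ ^ 2 / (4 * L) * (T k ω) ^ 2 *
          (f (quasarRun f L ρ (fun i => T i ω) w₀ z₀ k).w - f wstar) ≤
          c₀ * (1 / 2 * ‖z₀ - wstar‖ ^ 2) := by
        refine le_trans ?_ h3
        exact le_add_of_nonneg_right (by positivity)
      have h5 := sub_nonneg.2 (hq.minimizer (quasarRun f L ρ (fun i => T i ω) w₀ z₀ k).w)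
      set D := f (quasarRun f L ρ (fun i => T i ω) w₀ z₀ k).w - f wstar
      -- As `D ≥ 0`, replacing `T k ω` by its lower bound `(1 - c) k` only decreases the left side.
      have h6 : ρ ^ 2 / (4 * L) * ((1 - c) * k) ^ 2 * D ≤
          c₀ * (1 / 2 * ‖z₀ - wstar‖ ^ 2) := le_trans (by gcongr) h4
      rw [le_div_iff₀ (by positivity)]
      have h7 := mul_le_mul_of_nonneg_left h6 (show 0 ≤ 4 * L by positivity)
      have e : 4 * L * (ρ ^ 2 / (4 * L) * ((1 - c) * k) ^ 2 * D) =
          D * ((1 - c) ^ 2 * ρ ^ 2 * k ^ 2) := by field_simp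
      linarith
    have h1 := (measureReal_mono hcover (μ := P)).trans (measureReal_union_le _ _)
    have h2 := measureReal_union_le (μ := P) {ω | T k ω ≤ (1 - c) * k}
        {ω | c₀ * (1 / 2 * ‖z₀ - wstar‖ ^ 2) < X ω}
    rw [probReal_univ] at h1
    linarith
  refine ⟨main, fun ω => quasarRun_calls _ _ _ _, fun ε hε hkε => main.trans ?_⟩
  refine measureReal_mono fun ω hω => (show _ ≤ ε from le_trans hω ?_)
  have hsε := Real.sqrt_pos.2 hε
  -- Squaring the condition on `k` shows that the gap bound is at most `ε`.
  have h1 := pow_le_pow_left₀ (by positivity) hkε 2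
  rw [mul_pow, div_pow, div_pow, mul_pow, mul_pow, Real.sq_sqrt (by positivity),
    Real.sq_sqrt hL.le, Real.sq_sqrt hε.le, div_mul_div_comm, div_le_iff₀ (by positivity)] at h1
  rw [div_le_iff₀ (by positivity)]
  linarith
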